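/- Let $d\ge 2$, let $\mu\in\mathbb R^d$ and let $\Sigma=\mathrm{diag}(\sigma_1^2,\dots,\sigma_d^2)$ be a positive definite diagonal matrix. Let $\mathcal D$ be the law of $(x,y)$ where $y$ is uniform on $\{-1,1\}$ and, given $y$, $x\sim\mathcal N(y\mu,\Sigma)$. For a measurable classifier $\mathcal C:\mathbb R^d\to\{-1,1\}$ and a real budget $k\ge 0$ let $$\mathcal L_{\mu,\Sigma}(\mathcal C,k)=\mathbb E_{(x,y)\sim\mathcal D}\Big[\max_{x'\in\mathbb R^d:\ \|x-x'\|_0\le k}\mathbf 1\{\mathcal C(x')\ne y\}\Big],\qquad \mathcal L^*_{\mu,\Sigma}(k)=\inf_{\mathcal C}\mathcal L_{\mu,\Sigma}(\mathcal C,k),$$ where $\|z\|_0$ is the number of non-zero coordinates of $z$. Put $\nu=\Sigma^{-1/2}\mu$, i.e. $\nu_i=\mu_i/\sigma_i$, and assume that $\|\nu\|_2=1$ and $|\nu_1|\ge|\nu_2|\ge\dots\ge|\nu_d|$. Write $\nu_{[1:\lambda]}=(\nu_1,\dots,\nu_\lambda)$ and, for $c\in[0,1]$, let $\lambda_c$ be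 the least $\lambda\in\{1,\dots,d\}$ with $\|\nu_{[1:\lambda]}\|_2\ge c$. Let $\bar\Phi=1-\Phi$ be the complementary CDF of the standard normal distribution, and let $\log$ be the natural logarithm. Then: 1. For every $0\le c<1$, $$\mathcal L^*_{\mu,\Sigma}\Big(\frac{\|\nu_{[1:\lambda_c]}\|_1}{\log d}\Big)\le\frac1{\sqrt{2\log d}}+\bar\Phi\Big(\sqrt{1-c^2}-\frac{16\sqrt2}{\sqrt{1-c^2}\,\sqrt{\log d}}\Big).$$ 2. For every $0<c\le1$, $$\mathcal L^*_{\mu,\Sigma}\big(\|\nu_{[1:\lambda_c]}\|_1\log d\big)\ge\bar\Phi\big(\sqrt{1-c^2}\big)-\frac1{\log d}.$$ -/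

import Mathlib

open MeasureTheory ProbabilityTheory
open scoped ENNReal MatrixOrder

namespace SparseRobust

noncomputable section

/-- The complementary CDF of the standard normal distribution. -/
def gaussianTail (x : ℝ) : ℝ := 1 - cdf (gaussianReal 0 1) x

/-- The binary Gaussian mixture: the joint law of `(x, y)` where the label `y` is uniform on
`{1, -1}` and, given `y`, the input `x` is Gaussian with mean `y μ` and covariance `S`. -/
def mixture {d : ℕ} (μ : EuclideanSpace ℝ (Fin d)) (S : Matrix (Fin d) (Fin d) ℝ) :
    Measure (EuclideanSpace ℝ (Fin d) × ℤˣ) :=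
  (2⁻¹ : ℝ≥0∞) • ∑ y : ℤˣ,
    (multivariateGaussian (((y : ℤ) : ℝ) • μ) S).map (fun x => (x, y))

/-- The `ℓ₀`-ball of (real) radius `k`: the vectors that differ from `x` in at most `k`
coordinates. -/
def l0Ball {d : ℕ} (x : EuclideanSpace ℝ (Fin d)) (k : ℝ) : Set (EuclideanSpace ℝ (Fin d)) :=
  {x' | (hammingNorm (fun i => (x - x') i) : ℝ) ≤ k}

/-- The 0-1 loss of the classifier `C` at `(x, y)`. -/
def zeroOneLoss {d : ℕ} (C : EuclideanSpace ℝ (Fin d) → ℤˣ) (x : EuclideanSpace ℝ (Fin d))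
    (y : ℤˣ) : ℝ≥0∞ :=
  if C x ≠ y then 1 else 0

/-- The robust classification error of `C` against `ℓ₀`-perturbations of budget `k`. -/
def robustError {d : ℕ} (μ : EuclideanSpace ℝ (Fin d)) (S : Matrix (Fin d) (Fin d) ℝ)
    (C : EuclideanSpace ℝ (Fin d) → ℤˣ) (k : ℝ) : ℝ≥0∞ :=
  ∫⁻ p, ⨆ x' ∈ l0Ball p.1 k, zeroOneLoss C x' p.2 ∂(mixture μ S)

/-- The optimal robust classification error: the infimum of the robust error over all
(measurable) classifiers. -/
def optRobustError {d : ℕ} (μ : EuclideanSpace ℝ (Fin d)) (S : Matrix (Fin d) (Fin d) ℝ)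
    (k : ℝ) : ℝ :=
  (⨅ C : {C : EuclideanSpace ℝ (Fin d) → ℤˣ // Measurable C}, robustError μ S C.1 k).toReal

/-- The normalized mean `ν = S^{-1/2} μ`. -/
def normalizedMean {d : ℕ} (μ : EuclideanSpace ℝ (Fin d)) (S : Matrix (Fin d) (Fin d) ℝ) :
    EuclideanSpace ℝ (Fin d) :=
  Matrix.toEuclideanCLM (𝕜 := ℝ) (CFC.sqrt S)⁻¹ μ

/-- The `ℓ₁`-norm of the subvector of the first `l` coordinates. -/
def headL1 {d : ℕ} (ν : EuclideanSpace ℝ (Fin d)) (l : ℕ) : ℝ :=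
  ∑ i : Fin d with i.val < l, |ν i|

/-- The `ℓ₂`-norm of the subvector of the first `l` coordinates. -/
def headL2 {d : ℕ} (ν : EuclideanSpace ℝ (Fin d)) (l : ℕ) : ℝ :=
  √(∑ i : Fin d with i.val < l, ν i ^ 2)

/-- `λ_c`: the least `l ∈ {1, …, d}` such that the first `l` coordinates of `ν` have `ℓ₂`-norm
at least `c`. -/
def headLength {d : ℕ} (ν : EuclideanSpace ℝ (Fin d)) (c : ℝ) : ℕ :=
  sInf {l : ℕ | 1 ≤ l ∧ l ≤ d ∧ c ≤ headL2 ν l}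

end

end SparseRobust

namespace SparseRobust

/-! Dividing each coordinate by its standard deviation preserves the number of changed coordinates,
so the data may be taken isotropic with mean `y ν` (`robustError_eq_labelError`).

Upper bound: drop the first `λ_c - 1` coordinates and classify by the linear score `∑ w i * z i` of
the rest, each coordinate truncated at `M ≈ √(2 log d)`. Truncation rarely affects clean data, yet
`k` corrupted coordinates move the score by at most `2 M k b`, with `b = |ν_{λ_c}|` the largest
remaining weight. By sorting, `‖ν_[1:λ_c]‖₁ * b ≤ 1`, so at the given budget the shift is `O(1/√log
d)`, while the score has mean and variance `s² ≥ 1 - c²` (`labelError_clippedClassifier_le`,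
`exists_labelError_le`).

Lower bound: the adversary keeps each of the first `λ_c` coordinates with probability the truncated
likelihood ratio and otherwise sets it to `0`. The kept mass has density the minimum of the two
Gaussian densities, so the result carries no information on `y` (`eraseLaw_neg`). Coordinate `i` is
erased with probability at most `|ν i|`; by Markov the budget is exceeded with probability at most
`1/log d`. Only the tail of `ν` then separates the labels, and the Bayes error of that test is a
Gaussian tail (`two_mul_gaussianTail_le`, `erasedLaw_le_labelError`). -/

instance : DiscreteMeasurableSpace ℤˣ where
  forall_measurableSet s := ⟨Units.val '' s, MeasurableSet.of_discrete,
    Set.preimage_image_eq s Units.val_injective⟩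

/-! ### Reduction to isotropic Gaussian data. -/

theorem sqrt_diagonal {d : ℕ} {S : Matrix (Fin d) (Fin d) ℝ} (hS : S.PosDef) (hdiag : S.IsDiag) :
    CFC.sqrt S = Matrix.diagonal fun i => √(S i i) := by
  refine CFC.sqrt_unique ?_ ?_
  · rw [Matrix.diagonal_mul_diagonal]
    conv_rhs => rw [← hdiag.diagonal_diag]
    congr 1
    ext i
    exact Real.mul_self_sqrt hS.diag_pos.le
  · rw [Matrix.nonneg_iff_posSemidef]
    exact Matrix.PosSemidef.diagonal fun i => Real.sqrt_nonneg _

theorem normalizedMean_apply {d : ℕ} (μ : EuclideanSpace ℝ (Fin d)) {S : Matrix (Fin d) (Fin d) ℝ}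
    (hS : S.PosDef) (hdiag : S.IsDiag) (i : Fin d) :
    √(S i i) * normalizedMean μ S i = μ i := by
  have hpos : ∀ i, √(S i i) ≠ 0 := fun i => (Real.sqrt_pos.2 hS.diag_pos).ne'
  have hinv : (Matrix.diagonal fun i => √(S i i))⁻¹ = Matrix.diagonal fun i => (√(S i i))⁻¹ := by
    refine Matrix.inv_eq_right_inv ?_
    rw [Matrix.diagonal_mul_diagonal]
    simp [hpos]
  rw [normalizedMean, sqrt_diagonal hS hdiag, hinv]
  simp [Matrix.ofLp_toEuclideanCLM, Matrix.mulVec_diagonal, mul_inv_cancel_left₀ (hpos i)]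

/-- The coordinatewise rescaling by the standard deviations. -/
noncomputable def rescale {d : ℕ} (S : Matrix (Fin d) (Fin d) ℝ) (z : Fin d → ℝ) :
    EuclideanSpace ℝ (Fin d) := WithLp.toLp 2 fun i => √(S i i) * z i

/-- The coordinatewise division by the standard deviations. -/
noncomputable def unscale {d : ℕ} (S : Matrix (Fin d) (Fin d) ℝ) (x : EuclideanSpace ℝ (Fin d)) :
    Fin d → ℝ := fun i => (√(S i i))⁻¹ * x i

theorem measurable_rescale {d : ℕ} (S : Matrix (Fin d) (Fin d) ℝ) : Measurable (rescale S) := by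
  unfold rescale; fun_prop

theorem measurable_unscale {d : ℕ} (S : Matrix (Fin d) (Fin d) ℝ) : Measurable (unscale S) := by
  unfold unscale; fun_prop

theorem unscale_rescale {d : ℕ} {S : Matrix (Fin d) (Fin d) ℝ} (hS : S.PosDef) (z : Fin d → ℝ) :
    unscale S (rescale S z) = z := by
  ext i
  simp [unscale, rescale, inv_mul_cancel_left₀ (Real.sqrt_pos.2 (hS.diag_pos (i := i))).ne']

theorem rescale_unscale {d : ℕ} {S : Matrix (Fin d) (Fin d) ℝ} (hS : S.PosDef)
    (x : EuclideanSpace ℝ (Fin d)) : rescale S (unscale S x) = x := by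
  ext i
  simp [unscale, rescale, mul_inv_cancel_left₀ (Real.sqrt_pos.2 (hS.diag_pos (i := i))).ne']

/-- `rescale` as a measurable equivalence. -/
noncomputable def rescaleEquiv {d : ℕ} {S : Matrix (Fin d) (Fin d) ℝ} (hS : S.PosDef) :
    (Fin d → ℝ) ≃ᵐ EuclideanSpace ℝ (Fin d) where
  toFun := rescale S
  invFun := unscale S
  left_inv := unscale_rescale hS
  right_inv := rescale_unscale hS
  measurable_toFun := measurable_rescale S
  measurable_invFun := measurable_unscale S

/-- The Gaussian measure with identity covariance and mean `m`. -/
noncomputable def shiftedGaussian {d : ℕ} (m : Fin d → ℝ) : Measure (Fin d → ℝ) :=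
  Measure.pi fun i => gaussianReal (m i) 1

instance {d : ℕ} (m : Fin d → ℝ) : IsProbabilityMeasure (shiftedGaussian m) := by
  unfold shiftedGaussian; infer_instance

theorem multivariateGaussian_eq_map {d : ℕ} (μ : EuclideanSpace ℝ (Fin d))
    {S : Matrix (Fin d) (Fin d) ℝ} (hS : S.PosDef) (hdiag : S.IsDiag) (t : ℝ) :
    multivariateGaussian (t • μ) S =
      (shiftedGaussian fun i => t * normalizedMean μ S i).map (rescaleEquiv hS) := by
  have hshift : (shiftedGaussian fun i => t * normalizedMean μ S i) =
      (Measure.pi fun _ : Fin d => gaussianReal 0 1).map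
        fun z i => z i + t * normalizedMean μ S i := by
    rw [Measure.pi_map_pi (f := fun i x => x + t * normalizedMean μ S i) (by fun_prop),
      shiftedGaussian]
    congr 1
    ext1 i
    rw [gaussianReal_map_add_const, zero_add]
  rw [multivariateGaussian, ← map_pi_eq_stdGaussian, hshift,
    Measure.map_map (by fun_prop) (by fun_prop),
    Measure.map_map (rescaleEquiv hS).measurable (by fun_prop)]
  congr 1
  ext z i
  rw [sqrt_diagonal hS hdiag]
  simp only [Function.comp_apply, rescaleEquiv, MeasurableEquiv.coe_mk, Equiv.coe_fn_mk, rescale,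
    mul_add, mul_left_comm _ t, normalizedMean_apply μ hS hdiag]
  simp [Matrix.mulVec_diagonal, add_comm]

/-- Robust error, given the label `y`, of a classifier of isotropic Gaussian data with mean
`y m`. -/
noncomputable def labelError {d : ℕ} (m : Fin d → ℝ) (C : (Fin d → ℝ) → ℤˣ) (k : ℝ) (y : ℤˣ) :
    ℝ≥0∞ :=
  ∫⁻ z, ⨆ z' ∈ {z' : Fin d → ℝ | (hammingNorm (z - z') : ℝ) ≤ k},
    (if C z' ≠ y then 1 else 0 : ℝ≥0∞) ∂(shiftedGaussian fun i => ((y : ℤ) : ℝ) * m i)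

/-- Multiplying coordinates by the nonzero `√(S i i)` maps `ℓ₀`-balls onto `ℓ₀`-balls, so the inner
supremum is unchanged. -/
theorem robustError_eq_labelError {d : ℕ} (μ : EuclideanSpace ℝ (Fin d))
    {S : Matrix (Fin d) (Fin d) ℝ} (hS : S.PosDef) (hdiag : S.IsDiag)
    (C : EuclideanSpace ℝ (Fin d) → ℤˣ) (k : ℝ) :
    robustError μ S C k =
      2⁻¹ * (labelError (normalizedMean μ S) (C ∘ rescale S) k 1 +
        labelError (normalizedMean μ S) (C ∘ rescale S) k (-1)) := by
  have key : ∀ y : ℤˣ, ∫⁻ p, ⨆ x' ∈ l0Ball p.1 k, zeroOneLoss C x' p.2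
      ∂((multivariateGaussian (((y : ℤ) : ℝ) • μ) S).map fun x => (x, y)) =
      labelError (normalizedMean μ S) (C ∘ rescale S) k y := by
    intro y
    rw [(measurableEmbedding_prod_mk_right y).lintegral_map,
      multivariateGaussian_eq_map μ hS hdiag, lintegral_map_equiv, labelError]
    refine lintegral_congr fun z => ?_
    have hball : ∀ z' : Fin d → ℝ, rescale S z' ∈ l0Ball (rescale S z) k ↔
        (hammingNorm (z - z') : ℝ) ≤ k := by
      intro z'
      have : hammingNorm (fun i => (rescale S z - rescale S z') i) = hammingNorm (z - z') := by
        refine Finset.card_bij (fun i _ => i) ?_ (by simp) ?_ <;>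
        · intro i
          have := (Real.sqrt_pos.2 (hS.diag_pos (i := i))).ne'
          simp [rescale, ← mul_sub, this]
      rw [l0Ball, Set.mem_ofPred_eq, this]
    rw [← (rescaleEquiv hS).surjective.iSup_comp]
    simp only [rescaleEquiv, MeasurableEquiv.coe_mk, Equiv.coe_fn_mk, hball, zeroOneLoss,
      Set.mem_ofPred_eq, Function.comp_apply]
    rfl
  rw [robustError, mixture, lintegral_smul_measure, lintegral_finsetSum_measure]
  have huniv : (Finset.univ : Finset ℤˣ) = {1, -1} := rfl
  rw [huniv, Finset.sum_pair (by decide), key, key, smul_eq_mul]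

/-! ### Gaussian linear statistics and tail estimates. -/

/-- Characteristic functions multiply. Gaussianity is asked only where `w i ≠ 0`, because erased
coordinates are not Gaussian but get weight zero. -/
theorem map_linear_pi {d : ℕ} (ρ : Fin d → Measure ℝ) [∀ i, IsProbabilityMeasure (ρ i)]
    (w m : Fin d → ℝ) (h : ∀ i, w i ≠ 0 → ρ i = gaussianReal (m i) 1) :
    (Measure.pi ρ).map (fun x => ∑ i, w i * x i) =
      gaussianReal (∑ i, w i * m i) (∑ i, w i ^ 2).toNNReal := by
  have hmeas : Measurable fun x : Fin d → ℝ => ∑ i, w i * x i := by fun_prop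
  have := Measure.isProbabilityMeasure_map (μ := Measure.pi ρ) hmeas.aemeasurable
  refine Measure.ext_of_charFun ?_
  ext t
  rw [charFun_apply_real, integral_map hmeas.aemeasurable (by fun_prop), charFun_gaussianReal]
  have hfac : ∀ x : Fin d → ℝ, Complex.exp (t * ((∑ i, w i * x i : ℝ) : ℂ) * Complex.I) =
      ∏ i, Complex.exp (((t * w i : ℝ) : ℂ) * (x i : ℂ) * Complex.I) := by
    intro x
    rw [← Complex.exp_sum]
    push_cast
    rw [Finset.mul_sum, Finset.sum_mul]
    congr 1
    refine Finset.sum_congr rfl fun i _ => by ring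
  simp_rw [hfac]
  rw [integral_fintype_prod_eq_prod
    (f := fun i (x : ℝ) => Complex.exp (((t * w i : ℝ) : ℂ) * (x : ℂ) * Complex.I))]
  simp_rw [← charFun_apply_real]
  have hone : ∀ i, charFun (ρ i) (t * w i) =
      Complex.exp (t * (w i * m i : ℝ) * Complex.I - (w i ^ 2 : ℝ) * t ^ 2 / 2) := by
    intro i
    by_cases hw : w i = 0
    · simp [hw]
    · rw [h i hw, charFun_gaussianReal]
      congr 1
      push_cast
      ring
  simp_rw [hone]
  rw [← Complex.exp_sum, Real.coe_toNNReal _ (Finset.sum_nonneg fun i _ => sq_nonneg _),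
    Finset.sum_sub_distrib]
  push_cast
  rw [Finset.mul_sum, Finset.sum_mul, Finset.sum_mul, Finset.sum_div]

theorem gaussianTail_antitone : Antitone gaussianTail := fun _ _ h =>
  sub_le_sub_left (monotone_cdf _ h) 1

theorem gaussianTail_eq (x : ℝ) : gaussianTail x = (gaussianReal 0 1).real (Set.Ioi x) := by
  rw [gaussianTail, cdf_eq_real, ← probReal_compl_eq_one_sub measurableSet_Iic, Set.compl_Iic]

theorem gaussianTail_nonneg (x : ℝ) : 0 ≤ gaussianTail x := by
  rw [gaussianTail_eq]; positivity

theorem gaussianTail_zero : gaussianTail 0 = 1 / 2 := by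
  have hmap : (gaussianReal 0 1).real (Set.Ioi 0) = (gaussianReal 0 1).real (Set.Iio 0) := by
    have h := gaussianReal_map_neg (μ := 0) (v := 1)
    rw [neg_zero] at h
    conv_lhs => rw [← h, map_measureReal_apply (by fun_prop) measurableSet_Ioi]
    congr 1
    ext x
    simp
  have hcompl : (gaussianReal 0 1).real (Set.Iio 0) = 1 - gaussianTail 0 := by
    have := nullSingletonClass_gaussianReal (μ := 0) (v := 1) one_ne_zero
    rw [gaussianTail, cdf_eq_real, sub_sub_cancel, measureReal_congr Iio_ae_eq_Iic]
  have := gaussianTail_eq 0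
  linarith

theorem gaussianReal_Iic {m s : ℝ} (hs : 0 < s) (t : ℝ) :
    (gaussianReal m (s ^ 2).toNNReal) (Set.Iic t) = ENNReal.ofReal (gaussianTail ((m - t) / s)) := by
  have := nullSingletonClass_gaussianReal (μ := 0) (v := 1) one_ne_zero
  have hmap : gaussianReal m (s ^ 2).toNNReal = (gaussianReal 0 1).map fun x => m - s * x := by
    have : (fun x => m - s * x) = (fun x => m - x) ∘ (fun x => s * x) := rfl
    rw [this, ← Measure.map_map (by fun_prop) (by fun_prop), gaussianReal_map_const_mul,
      gaussianReal_map_const_sub]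
    congr 1
    · ring
    · ext
      simp [sq_nonneg]
  rw [hmap, Measure.map_apply (by fun_prop) measurableSet_Iic, gaussianTail_eq, ofReal_measureReal,
    measure_congr Ioi_ae_eq_Ici]
  congr 1
  ext x
  simp [div_le_iff₀ hs, mul_comm, add_comm]

theorem gaussianReal_Ici {m s : ℝ} (hs : 0 < s) (t : ℝ) :
    (gaussianReal m (s ^ 2).toNNReal) (Set.Ici t) = ENNReal.ofReal (gaussianTail ((t - m) / s)) := by
  have h := gaussianReal_map_neg (μ := -m) (v := (s ^ 2).toNNReal)
  rw [neg_neg] at h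
  rw [← h, Measure.map_apply (by fun_prop) measurableSet_Ici]
  have : (fun x : ℝ => -x) ⁻¹' Set.Ici t = Set.Iic (-t) := by
    ext x
    simp
  rw [this, gaussianReal_Iic hs]
  congr 3
  ring

theorem two_le_sqrt_two_pi : 2 ≤ √(2 * Real.pi) := by
  rw [Real.le_sqrt (by norm_num) (by positivity)]
  nlinarith [Real.pi_gt_three]

theorem gaussianPDFReal_zero_one (x : ℝ) :
    gaussianPDFReal 0 1 x = (√(2 * Real.pi))⁻¹ * Real.exp (-x ^ 2 / 2) := by
  simp [gaussianPDFReal]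

theorem gaussianPDFReal_zero_one_le (x : ℝ) :
    gaussianPDFReal 0 1 x ≤ 2⁻¹ * Real.exp (-x ^ 2 / 2) := by
  rw [gaussianPDFReal_zero_one]
  gcongr
  exact two_le_sqrt_two_pi

theorem gaussianReal_Ioc_le (a : ℝ) :
    gaussianReal 0 1 (Set.Ioc (-a) a) ≤ ENNReal.ofReal a := by
  rw [gaussianReal_apply _ one_ne_zero]
  calc ∫⁻ x in Set.Ioc (-a) a, gaussianPDF 0 1 x
      ≤ ∫⁻ _ in Set.Ioc (-a) a, ENNReal.ofReal 2⁻¹ := by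
        refine lintegral_mono fun x => ENNReal.ofReal_le_ofReal ?_
        refine (gaussianPDFReal_zero_one_le x).trans ?_
        have : Real.exp (-x ^ 2 / 2) ≤ 1 := Real.exp_le_one_iff.2 (by nlinarith [sq_nonneg x])
        linarith
    _ = ENNReal.ofReal a := by
        rw [setLIntegral_const, Real.volume_Ioc, ← ENNReal.ofReal_mul (by norm_num)]
        congr 1
        ring

/-- On `x > t` the factor `x / t` is at least `1` and turns the Gaussian integrand into an exact
derivative. The `2` comes from `2 ≤ √(2π)`. -/
theorem gaussianTail_le {t : ℝ} (ht : 0 < t) :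
    gaussianTail t ≤ Real.exp (-t ^ 2 / 2) / (2 * t) := by
  have hderiv : ∀ x ∈ Set.Ioi t, HasDerivAt (fun x => -(Real.exp (-x ^ 2 / 2) / (2 * t)))
      (x / t * (2⁻¹ * Real.exp (-x ^ 2 / 2))) x := by
    intro x _
    have h1 : HasDerivAt (fun x : ℝ => -x ^ 2 / 2) (-x) x := by
      have := ((hasDerivAt_pow 2 x).neg).div_const 2
      refine this.congr_deriv ?_
      norm_num
      ring
    have := (h1.exp.div_const (2 * t)).neg
    refine this.congr_deriv ?_
    field_simp
  have hcont : ContinuousWithinAt (fun x => -(Real.exp (-x ^ 2 / 2) / (2 * t))) (Set.Ici t) t :=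
    Continuous.continuousWithinAt (by fun_prop)
  have hpos : ∀ x ∈ Set.Ioi t, 0 ≤ x / t * (2⁻¹ * Real.exp (-x ^ 2 / 2)) := by
    intro x hx
    have : 0 < x := ht.trans hx
    positivity
  have hlim : Filter.Tendsto (fun x : ℝ => -(Real.exp (-x ^ 2 / 2) / (2 * t))) Filter.atTop
      (nhds 0) := by
    have h2 : Filter.Tendsto (fun x : ℝ => -x ^ 2 / 2) Filter.atTop Filter.atBot := by
      have := (Filter.tendsto_pow_atTop (α := ℝ) (n := 2) (by norm_num)).atTop_div_const
        (show (0 : ℝ) < 2 by norm_num)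
      simp_rw [neg_div]
      exact Filter.tendsto_neg_atTop_atBot.comp this
    have := ((Real.tendsto_exp_atBot.comp h2).div_const (2 * t)).neg
    simpa using this
  rw [gaussianTail_eq, measureReal_def, gaussianReal_apply_eq_integral _ one_ne_zero,
    ENNReal.toReal_ofReal (setIntegral_nonneg measurableSet_Ioi fun x _ =>
      gaussianPDFReal_nonneg _ _ _)]
  calc ∫ x in Set.Ioi t, gaussianPDFReal 0 1 x
      ≤ ∫ x in Set.Ioi t, x / t * (2⁻¹ * Real.exp (-x ^ 2 / 2)) := by
        refine setIntegral_mono_on (integrable_gaussianPDFReal 0 1).integrableOn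
          (integrableOn_Ioi_deriv_of_nonneg hcont hderiv hpos hlim) measurableSet_Ioi ?_
        intro x hx
        have hx' : 1 ≤ x / t := (one_le_div ht).2 (le_of_lt hx)
        exact (gaussianPDFReal_zero_one_le x).trans
          (le_mul_of_one_le_left (by positivity) hx')
    _ = Real.exp (-t ^ 2 / 2) / (2 * t) := by
        rw [integral_Ioi_of_hasDerivAt_of_nonneg hcont hderiv hpos hlim]
        ring

theorem gaussianReal_compl_Icc_le (m : ℝ) {t : ℝ} (ht : 0 < t) :
    gaussianReal m 1 {x | t ≤ |x - m|} ≤ ENNReal.ofReal (Real.exp (-t ^ 2 / 2) / t) := by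
  have h1 := gaussianReal_Iic (m := m) one_pos (m - t)
  have h2 := gaussianReal_Ici (m := m) one_pos (m + t)
  simp only [one_pow, Real.toNNReal_one, div_one, sub_sub_cancel, add_sub_cancel_left] at h1 h2
  calc gaussianReal m 1 {x | t ≤ |x - m|}
      ≤ gaussianReal m 1 (Set.Iic (m - t) ∪ Set.Ici (m + t)) := by
        refine measure_mono fun x hx => ?_
        rcases le_abs.1 (show t ≤ |x - m| from hx) with h | h
        · exact Or.inr (show m + t ≤ x by linarith)
        · exact Or.inl (show x ≤ m - t by linarith)
    _ ≤ ENNReal.ofReal (gaussianTail t) + ENNReal.ofReal (gaussianTail t) := by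
        refine (measure_union_le _ _).trans ?_
        rw [h1, h2]
    _ ≤ ENNReal.ofReal (Real.exp (-t ^ 2 / 2) / t) := by
        rw [← ENNReal.ofReal_add (gaussianTail_nonneg t) (gaussianTail_nonneg t)]
        refine ENNReal.ofReal_le_ofReal ?_
        have := gaussianTail_le ht
        have e : Real.exp (-t ^ 2 / 2) / t = 2 * (Real.exp (-t ^ 2 / 2) / (2 * t)) := by
          field_simp
        linarith

/-! ### The truncated linear classifier. -/

/-- Truncation of a real number to the interval `[-M, M]`. -/
noncomputable def clip (M x : ℝ) : ℝ := max (-M) (min M x)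

theorem clip_of_abs_le {M x : ℝ} (h : |x| ≤ M) : clip M x = x := by
  rw [clip, min_eq_right (abs_le.1 h).2, max_eq_right (abs_le.1 h).1]

theorem abs_clip_le {M : ℝ} (hM : 0 ≤ M) (x : ℝ) : |clip M x| ≤ M :=
  abs_le.2 ⟨le_max_left _ _, max_le (by linarith) (min_le_left _ _)⟩

/-- The linear classifier with weights `w` applied to the truncated coordinates. -/
noncomputable def clippedClassifier {d : ℕ} (w : Fin d → ℝ) (M : ℝ) (z : Fin d → ℝ) : ℤˣ :=
  if 0 ≤ ∑ i, w i * clip M (z i) then 1 else -1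

theorem measurable_clippedClassifier {d : ℕ} (w : Fin d → ℝ) (M : ℝ) :
    Measurable (clippedClassifier w M) := by
  unfold clippedClassifier clip
  refine Measurable.ite (measurableSet_le measurable_const ?_) measurable_const measurable_const
  fun_prop

theorem clippedClassifier_eq {d : ℕ} {w : Fin d → ℝ} {M : ℝ} {z : Fin d → ℝ} {y : ℤˣ}
    (h : 0 < ((y : ℤ) : ℝ) * ∑ i, w i * clip M (z i)) : clippedClassifier w M z = y := by
  rcases Int.units_eq_one_or y with rfl | rfl
  · exact if_pos (by simpa using h.le)
  · exact if_neg (by simpa using h)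

/-- Truncation caps the effect of one corrupted coordinate at `2 * M * b`, however large the
corruption. -/
theorem abs_sum_clip_sub_le {d : ℕ} {w : Fin d → ℝ} {M b k : ℝ} (hb : ∀ i, |w i| ≤ b)
    (hM : 0 ≤ M) (hb0 : 0 ≤ b) {z z' : Fin d → ℝ} (hk : (hammingNorm (z - z') : ℝ) ≤ k) :
    |∑ i, w i * clip M (z i) - ∑ i, w i * clip M (z' i)| ≤ 2 * M * (k * b) := by
  rw [← Finset.sum_sub_distrib]
  calc |∑ i, (w i * clip M (z i) - w i * clip M (z' i))|
      ≤ ∑ i, |w i * clip M (z i) - w i * clip M (z' i)| := Finset.abs_sum_le_sum_abs _ _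
    _ ≤ ∑ i, if (z - z') i ≠ 0 then 2 * M * b else 0 := by
        refine Finset.sum_le_sum fun i _ => ?_
        split_ifs with hi
        · rw [← mul_sub, abs_mul]
          have h1 := (abs_sub (clip M (z i)) (clip M (z' i))).trans
            (add_le_add (abs_clip_le hM (z i)) (abs_clip_le hM (z' i)))
          calc |w i| * |clip M (z i) - clip M (z' i)| ≤ b * (M + M) := by
                gcongr
                exact hb i
            _ = 2 * M * b := by ring
        · rw [not_not, Pi.sub_apply, sub_eq_zero] at hi
          simp [hi]
    _ = hammingNorm (z - z') * (2 * M * b) := by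
        rw [← Finset.sum_filter, Finset.sum_const, nsmul_eq_mul, hammingNorm]
    _ ≤ k * (2 * M * b) := by gcongr
    _ = 2 * M * (k * b) := by ring

theorem shiftedGaussian_exists_le {d : ℕ} (m : Fin d → ℝ) {t : ℝ} (ht : 0 < t) :
    shiftedGaussian m {z | ∃ i, t ≤ |z i - m i|} ≤
      ENNReal.ofReal (d * (Real.exp (-t ^ 2 / 2) / t)) := by
  have hset : {z : Fin d → ℝ | ∃ i, t ≤ |z i - m i|} =
      ⋃ i, (Function.eval i) ⁻¹' {x | t ≤ |x - m i|} := by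
    ext z; simp
  rw [hset]
  calc shiftedGaussian m (⋃ i, (Function.eval i) ⁻¹' {x | t ≤ |x - m i|})
      ≤ ∑ i, shiftedGaussian m ((Function.eval i) ⁻¹' {x | t ≤ |x - m i|}) :=
        measure_iUnion_fintype_le _ _
    _ ≤ ∑ _i : Fin d, ENNReal.ofReal (Real.exp (-t ^ 2 / 2) / t) := by
        refine Finset.sum_le_sum fun i _ => ?_
        rw [shiftedGaussian, (measurePreserving_eval (fun i => gaussianReal (m i) 1) i).measure_preimage
          (measurableSet_le (by fun_prop) (by fun_prop)).nullMeasurableSet]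
        exact gaussianReal_compl_Icc_le (m i) ht
    _ = ENNReal.ofReal (d * (Real.exp (-t ^ 2 / 2) / t)) := by
        rw [ENNReal.ofReal_mul (by positivity)]
        simp

/-- Since `w` is a restriction of `ν`, the signed score has mean and variance both equal to `s ^ 2`.
-/
theorem shiftedGaussian_linear_le {d : ℕ} {ν w : Fin d → ℝ} (hw : ∀ i, w i = 0 ∨ w i = ν i)
    {s : ℝ} (hs : 0 < s) (hsw : ∑ i, w i ^ 2 = s ^ 2) (y : ℤˣ) (a : ℝ) :
    shiftedGaussian (fun i => ((y : ℤ) : ℝ) * ν i) {z | ((y : ℤ) : ℝ) * ∑ i, w i * z i ≤ a} =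
      ENNReal.ofReal (gaussianTail (s - a / s)) := by
  have hy : ((y : ℤ) : ℝ) ^ 2 = 1 := by
    rcases Int.units_eq_one_or y with rfl | rfl <;> simp
  have hset : {z : Fin d → ℝ | ((y : ℤ) : ℝ) * ∑ i, w i * z i ≤ a} =
      (fun z : Fin d → ℝ => ∑ i, (((y : ℤ) : ℝ) * w i) * z i) ⁻¹' Set.Iic a := by
    ext z
    simp [Finset.mul_sum, mul_assoc]
  have hmean : ∑ i, (((y : ℤ) : ℝ) * w i) * (((y : ℤ) : ℝ) * ν i) = s ^ 2 := by
    rw [← hsw]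
    refine Finset.sum_congr rfl fun i _ => ?_
    rcases hw i with h | h
    · simp [h]
    · rw [h]
      linear_combination (ν i ^ 2) * hy
  have hvar : ∑ i, (((y : ℤ) : ℝ) * w i) ^ 2 = s ^ 2 := by
    rw [← hsw]
    refine Finset.sum_congr rfl fun i _ => ?_
    rw [mul_pow, hy, one_mul]
  rw [hset, shiftedGaussian, ← Measure.map_apply (by fun_prop) measurableSet_Iic,
    map_linear_pi _ _ (fun i => ((y : ℤ) : ℝ) * ν i) fun _ _ => rfl, hmean, hvar,
    gaussianReal_Iic hs]
  congr 2
  field_simp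

/-- Off `A` no clean coordinate is truncated; off `B` the clean margin exceeds what the adversary
can remove. The two terms bound the probabilities of `A` and `B`. -/
theorem labelError_clippedClassifier_le {d : ℕ} {ν w : Fin d → ℝ} {s M t b k : ℝ}
    (hw : ∀ i, w i = 0 ∨ w i = ν i) (hs : 0 < s) (hsw : ∑ i, w i ^ 2 = s ^ 2) (ht : 0 < t)
    (hM : ∀ i, |ν i| + t ≤ M) (hM0 : 0 ≤ M) (hb : ∀ i, |w i| ≤ b) (hb0 : 0 ≤ b) (y : ℤˣ) :
    labelError ν (clippedClassifier w M) k y ≤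
      ENNReal.ofReal (d * (Real.exp (-t ^ 2 / 2) / t)) +
        ENNReal.ofReal (gaussianTail (s - 2 * M * (k * b) / s)) := by
  have habs : |((y : ℤ) : ℝ)| = 1 := by
    rcases Int.units_eq_one_or y with rfl | rfl <;> simp
  set m : Fin d → ℝ := fun i => ((y : ℤ) : ℝ) * ν i with hm
  set A : Set (Fin d → ℝ) := {z | ∃ i, t ≤ |z i - m i|} with hA
  set B : Set (Fin d → ℝ) := {z | ((y : ℤ) : ℝ) * ∑ i, w i * z i ≤ 2 * M * (k * b)} with hB
  have hpt : ∀ z, (⨆ z' ∈ {z' : Fin d → ℝ | (hammingNorm (z - z') : ℝ) ≤ k},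
      (if clippedClassifier w M z' ≠ y then 1 else 0 : ℝ≥0∞)) ≤ (A ∪ B).indicator 1 z := by
    intro z
    refine iSup₂_le fun z' hz' => ?_
    by_cases hz : z ∈ A ∪ B
    · rw [Set.indicator_of_mem hz]
      split_ifs <;> simp
    · rw [Set.mem_union, not_or] at hz
      have hzA : ∀ i, |z i - m i| < t := by simpa [hA] using hz.1
      have hzB : 2 * M * (k * b) < ((y : ℤ) : ℝ) * ∑ i, w i * z i := by simpa [hB] using hz.2
      have hclip : ∀ i, clip M (z i) = z i := by
        intro i
        refine clip_of_abs_le ?_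
        have h1 : |m i| = |ν i| := by rw [hm, abs_mul, habs, one_mul]
        have h2 := abs_sub_abs_le_abs_sub (z i) (m i)
        linarith [hM i, hzA i]
      have hdiff := abs_sum_clip_sub_le hb hM0 hb0 hz'
      simp_rw [hclip] at hdiff
      have hprod : |((y : ℤ) : ℝ) * (∑ i, w i * z i - ∑ i, w i * clip M (z' i))| ≤
          2 * M * (k * b) := by rwa [abs_mul, habs, one_mul]
      have hC : clippedClassifier w M z' = y := by
        refine clippedClassifier_eq ?_
        have := (abs_le.1 hprod).2
        rw [mul_sub] at this
        linarith
      simp [hC]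
  have hmeas : MeasurableSet (A ∪ B) := by
    refine MeasurableSet.union ?_ (measurableSet_le (by fun_prop) (by fun_prop))
    have : A = ⋃ i, {z | t ≤ |z i - m i|} := by ext z; simp [hA]
    rw [this]
    exact MeasurableSet.iUnion fun i => measurableSet_le (by fun_prop) (by fun_prop)
  calc labelError ν (clippedClassifier w M) k y
      ≤ ∫⁻ z, (A ∪ B).indicator 1 z ∂(shiftedGaussian m) := lintegral_mono hpt
    _ = shiftedGaussian m (A ∪ B) := lintegral_indicator_one hmeas
    _ ≤ shiftedGaussian m A + shiftedGaussian m B := measure_union_le _ _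
    _ ≤ _ := add_le_add (shiftedGaussian_exists_le m ht)
        (shiftedGaussian_linear_le hw hs hsw y _).le

/-! ### Head norms of the mean and the upper bound. -/

section head

variable {d : ℕ} {ν : EuclideanSpace ℝ (Fin d)}

theorem sum_sq_eq_one (hnorm : ‖ν‖ = 1) : ∑ i, ν i ^ 2 = 1 := by
  rw [← EuclideanSpace.real_norm_sq_eq, hnorm, one_pow]

theorem headL2_sq (ν : EuclideanSpace ℝ (Fin d)) (l : ℕ) :
    headL2 ν l ^ 2 = ∑ i : Fin d with i.val < l, ν i ^ 2 :=
  Real.sq_sqrt (Finset.sum_nonneg fun _ _ => sq_nonneg _)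

theorem headL2_zero (ν : EuclideanSpace ℝ (Fin d)) : headL2 ν 0 = 0 := by
  simp [headL2]

theorem headL2_sq_le_one (hnorm : ‖ν‖ = 1) (l : ℕ) : headL2 ν l ^ 2 ≤ 1 := by
  rw [headL2_sq, ← sum_sq_eq_one hnorm]
  exact Finset.sum_le_sum_of_subset_of_nonneg (Finset.filter_subset _ _) fun _ _ _ => sq_nonneg _

theorem sum_tail_sq (hnorm : ‖ν‖ = 1) (l : ℕ) :
    ∑ i : Fin d, (if i.val < l then 0 else ν i) ^ 2 = 1 - headL2 ν l ^ 2 := by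
  rw [headL2_sq, ← sum_sq_eq_one hnorm, eq_sub_iff_add_eq, Finset.sum_filter,
    ← Finset.sum_add_distrib]
  refine Finset.sum_congr rfl fun i _ => ?_
  split_ifs <;> simp

theorem headLength_mem (hd : 1 ≤ d) (hnorm : ‖ν‖ = 1) {c : ℝ} (hc : c ≤ 1) :
    1 ≤ headLength ν c ∧ headLength ν c ≤ d ∧ c ≤ headL2 ν (headLength ν c) := by
  refine Nat.sInf_mem (s := {l : ℕ | 1 ≤ l ∧ l ≤ d ∧ c ≤ headL2 ν l}) ⟨d, hd, le_rfl, ?_⟩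
  have : headL2 ν d = 1 := by
    simp [headL2, sum_sq_eq_one hnorm]
  rwa [this]

/-- Minimality of `λ_c`, except when `λ_c = 1`: there the head is empty and `0 ≤ c` is what is
needed. -/
theorem headL2_pred_headLength_le (hd : 1 ≤ d) (hnorm : ‖ν‖ = 1) {c : ℝ} (hc0 : 0 ≤ c)
    (hc : c ≤ 1) : headL2 ν (headLength ν c - 1) ≤ c := by
  obtain ⟨h1, h2, -⟩ := headLength_mem hd hnorm hc
  rcases h1.eq_or_lt with h | h
  · rwa [← h, Nat.sub_self, headL2_zero]
  · have hnot : headLength ν c - 1 ∉ {l : ℕ | 1 ≤ l ∧ l ≤ d ∧ c ≤ headL2 ν l} :=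
      Nat.notMem_of_lt_sInf (show headLength ν c - 1 < headLength ν c by omega)
    by_contra hlt
    exact hnot ⟨by omega, by omega, (not_le.1 hlt).le⟩

theorem headL1_mul_le (hnorm : ‖ν‖ = 1) {l : ℕ} {b : ℝ}
    (hb : ∀ i : Fin d, i.val < l → b ≤ |ν i|) : headL1 ν l * b ≤ 1 := by
  refine le_trans ?_ (headL2_sq_le_one hnorm l)
  rw [headL1, headL2_sq, Finset.sum_mul]
  refine Finset.sum_le_sum fun i hi => ?_
  rw [← sq_abs, sq]
  exact mul_le_mul_of_nonneg_left (hb i (Finset.mem_filter.1 hi).2) (abs_nonneg _)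

theorem exists_labelError_le (hd : 2 ≤ d) (hnorm : ‖ν‖ = 1)
    (hsorted : ∀ i j : Fin d, i ≤ j → |ν j| ≤ |ν i|) {c : ℝ} (hc0 : 0 ≤ c) (hc1 : c < 1) :
    ∃ C : (Fin d → ℝ) → ℤˣ, Measurable C ∧ ∀ y,
      labelError ν C (headL1 ν (headLength ν c) / Real.log d) y ≤
        ENNReal.ofReal (1 / √(2 * Real.log d) + gaussianTail
          (√(1 - c ^ 2) - 16 * √2 / (√(1 - c ^ 2) * √(Real.log d)))) := by
  obtain ⟨hl1, hld, -⟩ := headLength_mem (by omega) hnorm hc1.le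
  have hpred := headL2_pred_headLength_le (by omega) hnorm hc0 hc1.le
  set l := headLength ν c with hl
  set L := Real.log d with hL
  have hd' : (2 : ℝ) ≤ d := by exact_mod_cast hd
  have hLhalf : 1 / 4 ≤ L := by
    have := Real.log_two_gt_d9
    have := Real.log_le_log (by norm_num) hd'
    linarith
  have hLpos : 0 < L := by linarith
  set r := √L with hr
  have hrsq : r ^ 2 = L := Real.sq_sqrt hLpos.le
  have hrhalf : 1 / 2 ≤ r := Real.le_sqrt_of_sq_le (by linarith)
  have hrpos : 0 < r := by linarith
  have ht : √(2 * L) = √2 * r := Real.sqrt_mul (by norm_num) _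
  have hsqrt2 : 1 ≤ √2 := Real.one_le_sqrt.2 (by norm_num)
  -- Only `l - 1` coordinates are dropped, so the remaining norm is at least `√(1 - c ^ 2)`. The
  -- largest remaining weight, at index `l - 1`, is still dominated by every head entry, which gives
  -- `hkb`.
  set w : Fin d → ℝ := fun i => if i.val < l - 1 then 0 else ν i with hw
  set b := |ν ⟨l - 1, by omega⟩| with hb
  set q := √(1 - c ^ 2) with hq
  have hqpos : 0 < q := Real.sqrt_pos.2 (by nlinarith)
  set s := √(1 - headL2 ν (l - 1) ^ 2) with hs
  have hqs : q ≤ s := Real.sqrt_le_sqrt (by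
    have : 0 ≤ headL2 ν (l - 1) := Real.sqrt_nonneg _
    nlinarith)
  have hspos : 0 < s := hqpos.trans_le hqs
  have hssq : ∑ i, w i ^ 2 = s ^ 2 := by
    rw [hs, Real.sq_sqrt (by linarith [headL2_sq_le_one hnorm (l - 1)]), ← sum_tail_sq hnorm]
  have hν1 : ∀ i, |ν i| ≤ 1 := fun i => by
    rw [← hnorm, ← Real.norm_eq_abs]
    exact PiLp.norm_apply_le ν i
  set M := 1 + √2 * r with hM
  have hkb : headL1 ν l / L * b ≤ 1 / L := by
    rw [div_mul_eq_mul_div]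
    gcongr
    refine headL1_mul_le hnorm fun i hi => hsorted _ _ ?_
    rw [Fin.le_def]
    change i.val ≤ l - 1
    omega
  refine ⟨clippedClassifier w M, measurable_clippedClassifier w M, fun y => ?_⟩
  have htpos : 0 < √2 * r := by positivity
  refine (labelError_clippedClassifier_le (k := headL1 ν l / L) (s := s) (t := √2 * r) (b := b)
    (fun i => ?_) hspos hssq htpos (fun i => by linarith [hν1 i]) (by positivity)
    (fun i => ?_) (abs_nonneg _) y).trans ?_
  · simp only [hw]
    split_ifs <;> simp
  · simp only [hw]
    split_ifs with hi
    · simp [hb]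
    · exact hsorted _ _ (by rw [Fin.le_def]; exact not_lt.1 hi)
  · rw [← ENNReal.ofReal_add (by positivity) (gaussianTail_nonneg _)]
    refine ENNReal.ofReal_le_ofReal (add_le_add (le_of_eq ?_) (gaussianTail_antitone ?_))
    -- The truncation slack `t = √(2 log d)` makes `d * exp (-t² / 2) = 1`, leaving `1 / t`.
    · rw [ht, mul_pow, hrsq, Real.sq_sqrt (by norm_num),
        show -(2 * L) / 2 = -L by ring, Real.exp_neg, hL, Real.exp_log (by linarith)]
      field_simp
    · have h1 : 2 * M * (headL1 ν l / L * b) / s ≤ 2 * M * (1 / L) / q := by gcongr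
      have h2 : 2 * M * (1 / L) / q ≤ 16 * √2 / (q * r) := by
        rw [← hrsq, div_le_div_iff₀ hqpos (by positivity)]
        have h3 : 2 * M * (1 / r ^ 2) * (q * r) = 2 * M * q / r := by field_simp
        rw [h3, div_le_iff₀ hrpos]
        have h4 : 2 * M ≤ 16 * √2 * r := by
          rw [hM]
          nlinarith
        nlinarith
      linarith

end head

/-! ### Random erasure of a single coordinate. -/

/-- The uniform distribution on the unit interval. -/
noncomputable def uniformUnit : Measure ℝ := volume.restrict (Set.Icc 0 1)

instance : IsProbabilityMeasure uniformUnit := ⟨by simp [uniformUnit]⟩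

theorem uniformUnit_Iic {r : ℝ} (h1 : r ≤ 1) :
    uniformUnit (Set.Iic r) = ENNReal.ofReal r := by
  have : Set.Iic r ∩ Set.Icc 0 1 = Set.Icc 0 r := by
    ext u
    simp only [Set.mem_inter_iff, Set.mem_Iic, Set.mem_Icc]
    constructor
    · rintro ⟨h, h', -⟩; exact ⟨h', h⟩
    · rintro ⟨h, h'⟩; exact ⟨h', h, h'.trans h1⟩
  rw [uniformUnit, Measure.restrict_apply measurableSet_Iic, this, Real.volume_Icc, sub_zero]

theorem uniformUnit_Ioi {r : ℝ} (h0 : 0 ≤ r) (h1 : r ≤ 1) :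
    uniformUnit (Set.Ioi r) = ENNReal.ofReal (1 - r) := by
  rw [← Set.compl_Iic, prob_compl_eq_one_sub measurableSet_Iic, uniformUnit_Iic h1,
    ENNReal.ofReal_sub _ h0, ENNReal.ofReal_one]

/-- The likelihood ratio of `N(-b, 1)` to `N(b, 1)` at `x`, truncated at `1`. -/
noncomputable def keepProb (b x : ℝ) : ℝ := min 1 (Real.exp (-(2 * b * x)))

theorem measurable_keepProb (b : ℝ) : Measurable (keepProb b) := by
  unfold keepProb; fun_prop

theorem keepProb_nonneg (b x : ℝ) : 0 ≤ keepProb b x := le_min zero_le_one (Real.exp_pos _).le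

theorem keepProb_le_one (b x : ℝ) : keepProb b x ≤ 1 := min_le_left _ _

theorem gaussianPDFReal_eq_exp_mul (b x : ℝ) :
    gaussianPDFReal b 1 x = Real.exp (2 * b * x) * gaussianPDFReal (-b) 1 x := by
  simp only [gaussianPDFReal, NNReal.coe_one, mul_one]
  rw [mul_left_comm, ← Real.exp_add]
  congr 2
  ring

theorem gaussianReal_eq_withDensity_neg (b : ℝ) :
    gaussianReal b 1 =
      (gaussianReal (-b) 1).withDensity fun x => ENNReal.ofReal (Real.exp (2 * b * x)) := by
  rw [gaussianReal_of_var_ne_zero _ one_ne_zero, gaussianReal_of_var_ne_zero _ one_ne_zero,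
    ← withDensity_mul _ (measurable_gaussianPDF _ _) (by fun_prop)]
  congr 1
  ext x
  rw [Pi.mul_apply, gaussianPDF, gaussianPDF, gaussianPDFReal_eq_exp_mul,
    ENNReal.ofReal_mul (Real.exp_pos _).le, mul_comm]

/-- Both sides integrate `g` against the minimum of the densities of `N(b, 1)` and `N(-b, 1)`, which
is symmetric in `b`. -/
theorem lintegral_keepProb_mul_neg (b : ℝ) {g : ℝ → ℝ≥0∞} (hg : Measurable g) :
    ∫⁻ x, ENNReal.ofReal (keepProb (-b) x) * g x ∂(gaussianReal (-b) 1) =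
      ∫⁻ x, ENNReal.ofReal (keepProb b x) * g x ∂(gaussianReal b 1) := by
  have hk := measurable_keepProb b
  rw [gaussianReal_eq_withDensity_neg b, lintegral_withDensity_eq_lintegral_mul _ (by fun_prop)
    (by fun_prop)]
  refine lintegral_congr fun x => ?_
  rw [Pi.mul_apply, ← mul_assoc, ← ENNReal.ofReal_mul (Real.exp_pos _).le]
  congr 2
  rw [keepProb, keepProb, mul_min_of_nonneg _ _ (Real.exp_pos _).le, ← Real.exp_add, min_comm]
  simp

theorem lintegral_keepProb_add (b : ℝ) :
    ∫⁻ x, ENNReal.ofReal (keepProb b x) ∂(gaussianReal b 1) +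
      ∫⁻ x, ENNReal.ofReal (1 - keepProb b x) ∂(gaussianReal b 1) = 1 := by
  have hk := measurable_keepProb b
  rw [← lintegral_add_left (by fun_prop)]
  have : ∀ x, ENNReal.ofReal (keepProb b x) + ENNReal.ofReal (1 - keepProb b x) = 1 := by
    intro x
    rw [← ENNReal.ofReal_add (keepProb_nonneg b x) (by linarith [keepProb_le_one b x])]
    simp
  simp [this]

theorem lintegral_keepProb_ne_top (b : ℝ) :
    ∫⁻ x, ENNReal.ofReal (keepProb b x) ∂(gaussianReal b 1) ≠ ∞ :=
  ne_top_of_le_ne_top ENNReal.one_ne_top (le_self_add.trans (lintegral_keepProb_add b).le)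

theorem lintegral_one_sub_keepProb_neg (b : ℝ) :
    ∫⁻ x, ENNReal.ofReal (1 - keepProb (-b) x) ∂(gaussianReal (-b) 1) =
      ∫⁻ x, ENNReal.ofReal (1 - keepProb b x) ∂(gaussianReal b 1) := by
  have h := lintegral_keepProb_mul_neg b (g := fun _ => 1) measurable_const
  simp only [mul_one] at h
  have h' := (lintegral_keepProb_add (-b)).trans (lintegral_keepProb_add b).symm
  rw [h] at h'
  exact (ENNReal.add_right_inj (lintegral_keepProb_ne_top b)).1 h'

/-- The erasure probability is a total variation distance. Erasure occurs only for `x > 0`, where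
the kept mass is that of `N(-b, 1)`; the difference is the standard normal mass of `(-b, b]`, at
most `2b * (1/2)`. -/
theorem lintegral_one_sub_keepProb_le_of_pos {b : ℝ} (hb : 0 < b) :
    ∫⁻ x, ENNReal.ofReal (1 - keepProb b x) ∂(gaussianReal b 1) ≤ ENNReal.ofReal b := by
  have hk := measurable_keepProb b
  have hshift : ∀ c : ℝ, gaussianReal c 1 (Set.Ioi 0) = gaussianReal 0 1 (Set.Ioi (-c)) := by
    intro c
    have h := gaussianReal_map_add_const (μ := 0) (v := 1) c
    rw [zero_add] at h
    rw [← h, Measure.map_apply (by fun_prop) measurableSet_Ioi]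
    congr 1
    ext x
    simp [neg_lt_iff_pos_add]
  have hpos : ∫⁻ x, ENNReal.ofReal (1 - keepProb b x) ∂(gaussianReal b 1) =
      ∫⁻ x in Set.Ioi 0, ENNReal.ofReal (1 - keepProb b x) ∂(gaussianReal b 1) := by
    rw [← lintegral_indicator measurableSet_Ioi]
    refine lintegral_congr fun x => ?_
    by_cases hx : 0 < x
    · rw [Set.indicator_of_mem (Set.mem_Ioi.2 hx)]
    · rw [Set.indicator_of_notMem (by simpa using hx), keepProb, min_eq_left]
      · simp
      · rw [Real.one_le_exp_iff]
        nlinarith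
  have hkeep : ∫⁻ x in Set.Ioi 0, ENNReal.ofReal (keepProb b x) ∂(gaussianReal b 1) =
      gaussianReal 0 1 (Set.Ioi b) := by
    have h := lintegral_keepProb_mul_neg b (g := (Set.Ioi 0).indicator 1)
      (measurable_one.indicator measurableSet_Ioi)
    have e := hshift (-b)
    rw [neg_neg] at e
    rw [← e, ← lintegral_indicator measurableSet_Ioi, ← lintegral_indicator_one measurableSet_Ioi]
    refine (lintegral_congr fun x => ?_).trans (h.symm.trans (lintegral_congr fun x => ?_))
    · by_cases hx : x ∈ Set.Ioi (0 : ℝ) <;> simp [hx]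
    · by_cases hx : x ∈ Set.Ioi (0 : ℝ)
      · have : keepProb (-b) x = 1 := by
          rw [keepProb, min_eq_left]
          rw [Real.one_le_exp_iff]
          have : 0 < x := hx
          nlinarith
        simp [hx, this]
      · simp [hx]
  have hsum : ∫⁻ x in Set.Ioi 0, ENNReal.ofReal (1 - keepProb b x) ∂(gaussianReal b 1) +
      gaussianReal 0 1 (Set.Ioi b) = gaussianReal b 1 (Set.Ioi 0) := by
    rw [← hkeep, ← lintegral_add_right _ (by fun_prop), ← setLIntegral_one]
    refine lintegral_congr fun x => ?_
    rw [← ENNReal.ofReal_add (by linarith [keepProb_le_one b x]) (keepProb_nonneg b x)]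
    simp
  rw [hpos]
  refine (ENNReal.add_le_add_iff_right (measure_ne_top (gaussianReal 0 1) (Set.Ioi b))).1 ?_
  rw [hsum, hshift]
  calc gaussianReal 0 1 (Set.Ioi (-b))
      ≤ gaussianReal 0 1 (Set.Ioc (-b) b ∪ Set.Ioi b) := measure_mono fun x hx => by
        rcases le_or_gt x b with h | h
        · exact Or.inl ⟨hx, h⟩
        · exact Or.inr h
    _ ≤ _ := (measure_union_le _ _).trans (add_le_add_left (gaussianReal_Ioc_le b) _)

theorem lintegral_one_sub_keepProb_le (b : ℝ) :
    ∫⁻ x, ENNReal.ofReal (1 - keepProb b x) ∂(gaussianReal b 1) ≤ ENNReal.ofReal |b| := by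
  rcases lt_trichotomy b 0 with h | rfl | h
  · rw [← lintegral_one_sub_keepProb_neg, abs_of_neg h]
    exact lintegral_one_sub_keepProb_le_of_pos (neg_pos.2 h)
  · simp [keepProb]
  · rw [abs_of_pos h]
    exact lintegral_one_sub_keepProb_le_of_pos h

/-- Keep the first component if the second one is at most `keepProb`, erase it otherwise. -/
noncomputable def erase (b : ℝ) (p : ℝ × ℝ) : ℝ := if p.2 ≤ keepProb b p.1 then p.1 else 0

theorem measurableSet_keep (b : ℝ) : MeasurableSet {p : ℝ × ℝ | p.2 ≤ keepProb b p.1} :=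
  measurableSet_le measurable_snd ((measurable_keepProb b).comp measurable_fst)

theorem measurable_erase (b : ℝ) : Measurable (erase b) :=
  Measurable.ite (measurableSet_keep b) measurable_fst measurable_const

/-- The law of a coordinate of mean `b` after random erasure. -/
noncomputable def eraseLaw (b : ℝ) : Measure ℝ :=
  ((gaussianReal b 1).prod uniformUnit).map (erase b)

instance (b : ℝ) : IsProbabilityMeasure (eraseLaw b) :=
  Measure.isProbabilityMeasure_map (measurable_erase b).aemeasurable

theorem eraseLaw_apply (b : ℝ) {B : Set ℝ} (hB : MeasurableSet B) :
    eraseLaw b B = ∫⁻ x, ENNReal.ofReal (keepProb b x) * B.indicator 1 x ∂(gaussianReal b 1) +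
      (∫⁻ x, ENNReal.ofReal (1 - keepProb b x) ∂(gaussianReal b 1)) * B.indicator 1 0 := by
  have hk := measurable_keepProb b
  rw [eraseLaw, Measure.map_apply (measurable_erase b) hB,
    Measure.prod_apply (measurable_erase b hB), ← lintegral_mul_const _ (by fun_prop),
    ← lintegral_add_right _ (by fun_prop)]
  refine lintegral_congr fun x => ?_
  have hx0 := keepProb_nonneg b x
  have hx1 := keepProb_le_one b x
  have hset : Prod.mk x ⁻¹' (erase b ⁻¹' B) =
      {u | u ∈ Set.Iic (keepProb b x) ∧ x ∈ B} ∪ {u | u ∈ Set.Ioi (keepProb b x) ∧ (0 : ℝ) ∈ B} := by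
    ext u
    by_cases hu : u ≤ keepProb b x <;> simp [erase, hu, not_lt.2, not_le.1]
  rw [hset, measure_union]
  · congr 1
    · by_cases hx : x ∈ B
      · simpa [hx] using! uniformUnit_Iic hx1
      · simp [hx]
    · by_cases hx : (0 : ℝ) ∈ B
      · simpa [hx] using! uniformUnit_Ioi hx0 hx1
      · simp [hx]
  · rw [Set.disjoint_left]
    rintro u ⟨h1, -⟩ ⟨h2, -⟩
    exact (not_le.2 (Set.mem_Ioi.1 h2)) (Set.mem_Iic.1 h1)
  · exact measurableSet_Ioi.inter (MeasurableSet.const _)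

/-- The kept part and the atom at `0` are both symmetric in `b`, so an erased coordinate hides the
label. -/
theorem eraseLaw_neg (b : ℝ) : eraseLaw (-b) = eraseLaw b := by
  ext B hB
  rw [eraseLaw_apply _ hB, eraseLaw_apply _ hB, lintegral_one_sub_keepProb_neg,
    lintegral_keepProb_mul_neg _ (measurable_one.indicator hB)]

theorem prob_erase_ne_le (b : ℝ) :
    ((gaussianReal b 1).prod uniformUnit) {p | p.2 ≤ keepProb b p.1}ᶜ ≤ ENNReal.ofReal |b| := by
  rw [Measure.prod_apply (measurableSet_keep b).compl]
  refine le_trans (le_of_eq (lintegral_congr fun x => ?_)) (lintegral_one_sub_keepProb_le b)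
  rw [← uniformUnit_Ioi (keepProb_nonneg b x) (keepProb_le_one b x)]
  congr 1
  ext u
  simp

/-! ### Optimal testing between the two erased laws. -/

theorem pi_withDensity {d : ℕ} (ρ : Fin d → Measure ℝ) [∀ i, IsProbabilityMeasure (ρ i)]
    {f : Fin d → ℝ → ℝ≥0∞} (hf : ∀ i, Measurable (f i))
    [∀ i, IsProbabilityMeasure ((ρ i).withDensity (f i))] :
    Measure.pi (fun i => (ρ i).withDensity (f i)) =
      (Measure.pi ρ).withDensity fun x => ∏ i, f i (x i) := by
  refine Measure.pi_eq fun s hs => ?_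
  rw [withDensity_apply _ (MeasurableSet.univ_pi hs),
    ← lintegral_indicator (MeasurableSet.univ_pi hs)]
  have hind : ∀ x : Fin d → ℝ, (Set.univ.pi s).indicator (fun x => ∏ i, f i (x i)) x =
      ∏ i, (s i).indicator (f i) (x i) := by
    intro x
    by_cases hx : x ∈ Set.univ.pi s
    · rw [Set.indicator_of_mem hx]
      exact Finset.prod_congr rfl fun i _ =>
        (Set.indicator_of_mem (hx i (Set.mem_univ i)) _).symm
    · rw [Set.indicator_of_notMem hx]
      simp only [Set.mem_univ_pi, not_forall] at hx
      obtain ⟨i, hi⟩ := hx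
      exact (Finset.prod_eq_zero (Finset.mem_univ i) (Set.indicator_of_notMem hi _)).symm
  simp_rw [hind]
  have hmeas : ∀ i, Measurable ((s i).indicator (f i)) := fun i => (hf i).indicator (hs i)
  refine (lintegral_prod_eq_prod_lintegral_of_indepFun Finset.univ
    (fun i (x : Fin d → ℝ) => (s i).indicator (f i) (x i))
    (iIndepFun_pi fun i => (hmeas i).aemeasurable)
    fun i => (hmeas i).comp (measurable_pi_apply i)).trans ?_
  refine Finset.prod_congr rfl fun i _ => ?_
  rw [withDensity_apply _ (hs i), ← lintegral_indicator (hs i),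
    (measurePreserving_eval ρ i).lintegral_comp (hmeas i)]

/-- Each error sum integrates either `f` or `1` at every point; the likelihood-ratio test `S` picks
the smaller one. -/
theorem bayes_error_le {α : Type*} [MeasurableSpace α] (Q : Measure α) {f : α → ℝ≥0∞}
    {A S : Set α} (hf : Measurable f) (hA : MeasurableSet A) (hS : MeasurableSet S)
    (h1 : ∀ x ∈ S, f x ≤ 1) (h2 : ∀ x ∉ S, 1 ≤ f x) :
    Q.withDensity f S + Q Sᶜ ≤ Q.withDensity f A + Q Aᶜ := by
  have key : ∀ T : Set α, MeasurableSet T → Q.withDensity f T + Q Tᶜ =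
      ∫⁻ x, (T.indicator f x + Tᶜ.indicator 1 x) ∂Q := by
    intro T hT
    rw [lintegral_add_left (hf.indicator hT), lintegral_indicator hT, withDensity_apply _ hT,
      lintegral_indicator_one hT.compl]
  rw [key S hS, key A hA]
  refine lintegral_mono fun x => ?_
  by_cases hxS : x ∈ S <;> by_cases hxA : x ∈ A <;> simp [hxS, hxA, h1, h2]

section erasure

variable {d : ℕ}

/-- The marginal laws, given the label `y`, after erasure of the first `l` coordinates. -/
noncomputable def erasedLaw (ν : Fin d → ℝ) (l : ℕ) (y : ℤˣ) (i : Fin d) : Measure ℝ :=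
  if i.val < l then eraseLaw (ν i) else gaussianReal (((y : ℤ) : ℝ) * ν i) 1

instance (ν : Fin d → ℝ) (l : ℕ) (y : ℤˣ) (i : Fin d) :
    IsProbabilityMeasure (erasedLaw ν l y i) := by
  unfold erasedLaw; split_ifs <;> infer_instance

theorem erasedLaw_one_eq_withDensity (ν : Fin d → ℝ) (l : ℕ) (i : Fin d) :
    erasedLaw ν l 1 i = (erasedLaw ν l (-1) i).withDensity
      fun x => ENNReal.ofReal (Real.exp (2 * (if i.val < l then 0 else ν i) * x)) := by
  unfold erasedLaw
  split_ifs with h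
  · simp only [mul_zero, zero_mul, Real.exp_zero, ENNReal.ofReal_one]
    exact withDensity_one.symm
  · simpa using gaussianReal_eq_withDensity_neg (ν i)

/-- Erased coordinates contribute a factor `1`, so the likelihood ratio depends only on the tail
score. -/
theorem pi_erasedLaw_one (ν : Fin d → ℝ) (l : ℕ) :
    Measure.pi (erasedLaw ν l 1) = (Measure.pi (erasedLaw ν l (-1))).withDensity
      fun x => ENNReal.ofReal (Real.exp (2 * ∑ i, (if i.val < l then 0 else ν i) * x i)) := by
  have hinst : ∀ i, IsProbabilityMeasure ((erasedLaw ν l (-1) i).withDensity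
      fun x => ENNReal.ofReal (Real.exp (2 * (if i.val < l then 0 else ν i) * x))) := fun i => by
    rw [← erasedLaw_one_eq_withDensity]
    infer_instance
  have h : erasedLaw ν l 1 = fun i => (erasedLaw ν l (-1) i).withDensity
      fun x => ENNReal.ofReal (Real.exp (2 * (if i.val < l then 0 else ν i) * x)) :=
    funext fun i => erasedLaw_one_eq_withDensity ν l i
  rw [h, pi_withDensity _ fun i => by fun_prop]
  congr 1
  ext x
  rw [← ENNReal.ofReal_prod_of_nonneg fun i _ => (Real.exp_pos _).le, ← Real.exp_sum,
    Finset.mul_sum]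
  simp_rw [mul_assoc]

theorem map_linear_erasedLaw (ν : Fin d → ℝ) (l : ℕ) (y : ℤˣ) {s : ℝ}
    (hs : ∑ i : Fin d, (if i.val < l then 0 else ν i) ^ 2 = s ^ 2) :
    (Measure.pi (erasedLaw ν l y)).map (fun x => ∑ i, (if i.val < l then 0 else ν i) * x i) =
      gaussianReal (((y : ℤ) : ℝ) * s ^ 2) (s ^ 2).toNNReal := by
  rw [map_linear_pi _ _ (fun i => ((y : ℤ) : ℝ) * ν i), hs]
  · congr 1
    rw [← hs, Finset.mul_sum]
    refine Finset.sum_congr rfl fun i _ => ?_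
    split_ifs
    · simp
    · ring
  · intro i hi
    rw [erasedLaw, if_neg]
    intro h
    exact hi (if_pos h)

theorem two_mul_gaussianTail_le (ν : Fin d → ℝ) (l : ℕ) {s : ℝ} (hs0 : 0 ≤ s)
    (hs : ∑ i : Fin d, (if i.val < l then 0 else ν i) ^ 2 = s ^ 2)
    {A : Set (Fin d → ℝ)} (hA : MeasurableSet A) :
    2 * ENNReal.ofReal (gaussianTail s) ≤
      Measure.pi (erasedLaw ν l 1) A + Measure.pi (erasedLaw ν l (-1)) Aᶜ := by
  have hmeas : Measurable fun x : Fin d → ℝ => ∑ i, (if i.val < l then 0 else ν i) * x i := by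
    fun_prop
  rw [two_mul]
  -- For `s = 0` the score is degenerate, but then the two laws coincide and the error sum is `1 = 2
  -- * gaussianTail 0`.
  rcases hs0.eq_or_lt with rfl | hspos
  · have hw : ∀ i : Fin d, (if i.val < l then 0 else ν i) = 0 := by
      intro i
      rw [zero_pow two_ne_zero, Finset.sum_eq_zero_iff_of_nonneg fun _ _ => sq_nonneg _] at hs
      exact pow_eq_zero_iff two_ne_zero |>.1 (hs i (Finset.mem_univ i))
    have hPQ := pi_erasedLaw_one ν l
    simp only [hw, zero_mul, Finset.sum_const_zero, mul_zero, Real.exp_zero,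
      ENNReal.ofReal_one] at hPQ
    rw [show (fun _ : Fin d → ℝ => (1 : ℝ≥0∞)) = 1 from rfl, withDensity_one] at hPQ
    rw [hPQ, measure_add_measure_compl hA, measure_univ,
      ← ENNReal.ofReal_add (gaussianTail_nonneg 0) (gaussianTail_nonneg 0), gaussianTail_zero]
    norm_num
  · have hS : MeasurableSet {x : Fin d → ℝ | ∑ i, (if i.val < l then 0 else ν i) * x i ≤ 0} :=
      hmeas measurableSet_Iic
    rw [pi_erasedLaw_one]
    refine le_trans ?_ (bayes_error_le _ (by fun_prop) hA hS ?_ ?_)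
    · rw [← pi_erasedLaw_one]
      refine add_le_add (le_of_eq ?_) (le_of_eq ?_)
      · have h := map_linear_erasedLaw ν l 1 hs
        have h' := gaussianReal_Iic (m := ((1 : ℤˣ) : ℤ) * s ^ 2) hspos 0
        rw [← h, Measure.map_apply hmeas measurableSet_Iic] at h'
        refine Eq.trans ?_ h'.symm
        congr 2
        simp
        field_simp
      · have h := map_linear_erasedLaw ν l (-1) hs
        have h' := gaussianReal_Ici (m := ((-1 : ℤˣ) : ℤ) * s ^ 2) hspos 0
        have hv : (s ^ 2).toNNReal ≠ 0 := by
          rw [Ne, Real.toNNReal_eq_zero, not_le]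
          positivity
        have := nullSingletonClass_gaussianReal (μ := ((-1 : ℤˣ) : ℤ) * s ^ 2) hv
        rw [← measure_congr Ioi_ae_eq_Ici, ← h, Measure.map_apply hmeas measurableSet_Ioi] at h'
        refine Eq.trans ?_ (h'.symm.trans ?_)
        · congr 2
          simp
          field_simp
        · congr 1
          ext x
          simp
    · intro x hx
      rw [ENNReal.ofReal_le_one, Real.exp_le_one_iff]
      have : ∑ i, (if i.val < l then 0 else ν i) * x i ≤ 0 := hx
      linarith
    · intro x hx
      rw [ENNReal.one_le_ofReal, Real.one_le_exp_iff]
      have : 0 < ∑ i, (if i.val < l then 0 else ν i) * x i := not_le.1 hx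
      linarith

/-! ### The randomized adversary and its budget. -/

/-- The perturbed input: randomly erase each of the first `l` coordinates. -/
noncomputable def perturb (ν : Fin d → ℝ) (l : ℕ) (y : ℤˣ) (p : Fin d → ℝ × ℝ) (i : Fin d) : ℝ :=
  if i.val < l then erase (((y : ℤ) : ℝ) * ν i) (p i) else (p i).1

theorem measurable_perturb (ν : Fin d → ℝ) (l : ℕ) (y : ℤˣ) : Measurable (perturb ν l y) := by
  refine measurable_pi_lambda _ fun i => ?_
  unfold perturb
  split_ifs
  · exact (measurable_erase _).comp (measurable_pi_apply i)
  · fun_prop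

/-- The joint law, given the label `y`, of the coordinates and of independent uniform seeds. -/
noncomputable def seededLaw (ν : Fin d → ℝ) (y : ℤˣ) : Measure (Fin d → ℝ × ℝ) :=
  Measure.pi fun i => (gaussianReal (((y : ℤ) : ℝ) * ν i) 1).prod uniformUnit

instance (ν : Fin d → ℝ) (y : ℤˣ) : IsProbabilityMeasure (seededLaw ν y) := by
  unfold seededLaw; infer_instance

/-- By `eraseLaw_neg` the label disappears from the first `l` marginals. -/
theorem map_perturb (ν : Fin d → ℝ) (l : ℕ) (y : ℤˣ) :
    (seededLaw ν y).map (perturb ν l y) = Measure.pi (erasedLaw ν l y) := by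
  have hg : ∀ i : Fin d, Measurable fun q : ℝ × ℝ =>
      if i.val < l then erase (((y : ℤ) : ℝ) * ν i) q else q.1 := by
    intro i
    split_ifs
    · exact measurable_erase _
    · fun_prop
  have hinst : ∀ i : Fin d, IsProbabilityMeasure
      (((gaussianReal (((y : ℤ) : ℝ) * ν i) 1).prod uniformUnit).map fun q : ℝ × ℝ =>
        if i.val < l then erase (((y : ℤ) : ℝ) * ν i) q else q.1) := fun i =>
    Measure.isProbabilityMeasure_map (hg i).aemeasurable
  have h := Measure.pi_map_pi
    (μ := fun i : Fin d => (gaussianReal (((y : ℤ) : ℝ) * ν i) 1).prod uniformUnit)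
    fun i => (hg i).aemeasurable
  refine Eq.trans h ?_
  congr 1
  ext1 i
  unfold erasedLaw
  split_ifs with hi
  · change eraseLaw (((y : ℤ) : ℝ) * ν i) = _
    rcases Int.units_eq_one_or y with rfl | rfl
    · simp
    · simpa using eraseLaw_neg (ν i)
  · exact measurePreserving_fst.map_eq

/-- The number of perturbed coordinates. -/
noncomputable def perturbCount (ν : Fin d → ℝ) (l : ℕ) (y : ℤˣ) (p : Fin d → ℝ × ℝ) : ℝ≥0∞ :=
  ∑ i : Fin d with i.val < l,
    {q : ℝ × ℝ | q.2 ≤ keepProb (((y : ℤ) : ℝ) * ν i) q.1}ᶜ.indicator 1 (p i)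

theorem measurable_perturbCount (ν : Fin d → ℝ) (l : ℕ) (y : ℤˣ) :
    Measurable (perturbCount ν l y) := by
  unfold perturbCount
  exact Finset.measurable_sum _ fun i _ =>
    (measurable_one.indicator (measurableSet_keep _).compl).comp (measurable_pi_apply i)

theorem hammingNorm_sub_perturb_le (ν : Fin d → ℝ) (l : ℕ) (y : ℤˣ) (p : Fin d → ℝ × ℝ) :
    (hammingNorm ((fun i => (p i).1) - perturb ν l y p) : ℝ≥0∞) ≤ perturbCount ν l y p := by
  rw [hammingNorm, Finset.card_eq_sum_ones, perturbCount]
  push_cast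
  rw [Finset.sum_filter, Finset.sum_filter]
  refine Finset.sum_le_sum fun i _ => ?_
  by_cases hi : i.val < l
  · by_cases hq : (p i).2 ≤ keepProb (((y : ℤ) : ℝ) * ν i) (p i).1
    · simp [perturb, erase, hi, hq]
    · rw [if_pos hi, Set.indicator_of_mem (by exact hq)]
      split_ifs <;> simp
  · simp [perturb, hi]

theorem lintegral_perturbCount_le (ν : EuclideanSpace ℝ (Fin d)) (l : ℕ) (y : ℤˣ) :
    ∫⁻ p, perturbCount ν l y p ∂(seededLaw ν y) ≤ ENNReal.ofReal (headL1 ν l) := by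
  have habs : |((y : ℤ) : ℝ)| = 1 := by
    rcases Int.units_eq_one_or y with rfl | rfl <;> simp
  have hm : ∀ i : Fin d, Measurable fun q : ℝ × ℝ =>
      {q : ℝ × ℝ | q.2 ≤ keepProb (((y : ℤ) : ℝ) * ν i) q.1}ᶜ.indicator (1 : ℝ × ℝ → ℝ≥0∞) q :=
    fun i => measurable_one.indicator (measurableSet_keep _).compl
  unfold perturbCount
  refine (lintegral_finsetSum _ fun i _ => (hm i).comp (measurable_pi_apply i)).trans_le ?_
  rw [headL1, ENNReal.ofReal_sum_of_nonneg fun _ _ => abs_nonneg _]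
  refine Finset.sum_le_sum fun i _ => ?_
  have h := (measurePreserving_eval
    (fun i : Fin d => (gaussianReal (((y : ℤ) : ℝ) * ν i) 1).prod uniformUnit) i).lintegral_comp
      (hm i)
  rw [seededLaw]
  refine (le_of_eq h).trans ?_
  rw [lintegral_indicator_one (measurableSet_keep _).compl]
  refine (prob_erase_ne_le _).trans ?_
  rw [abs_mul, habs, one_mul]

theorem prob_perturb_gt_le {ν : EuclideanSpace ℝ (Fin d)} {l : ℕ} (hl : 0 < headL1 ν l) {t : ℝ}
    (ht : 0 < t) (y : ℤˣ) :
    seededLaw ν y {p | ENNReal.ofReal (headL1 ν l * t) ≤ perturbCount ν l y p} ≤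
      ENNReal.ofReal (1 / t) := by
  have hpos : 0 < headL1 ν l * t := mul_pos hl ht
  refine (meas_ge_le_lintegral_div (measurable_perturbCount _ l y).aemeasurable
    (by simpa using hpos) ENNReal.ofReal_ne_top).trans ?_
  refine (ENNReal.div_le_div_right (lintegral_perturbCount_le ν l y) _).trans (le_of_eq ?_)
  rw [← ENNReal.ofReal_div_of_pos hpos]
  congr 1
  field_simp

/-- A random perturbation within budget is no stronger than the worst one; seeds that exceed the
budget cost `1 / t` by Markov. -/
theorem erasedLaw_le_labelError {ν : EuclideanSpace ℝ (Fin d)} {l : ℕ} (hl : 0 < headL1 ν l)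
    {t : ℝ} (ht : 0 < t) {C : (Fin d → ℝ) → ℤˣ} (hC : Measurable C) (y : ℤˣ) :
    Measure.pi (erasedLaw ν l y) {x | C x ≠ y} ≤
      labelError ν C (headL1 ν l * t) y + ENNReal.ofReal (1 / t) := by
  set E : Set (Fin d → ℝ × ℝ) := {p | C (perturb ν l y p) ≠ y} with hE
  set G : Set (Fin d → ℝ × ℝ) := {p | ENNReal.ofReal (headL1 ν l * t) ≤ perturbCount ν l y p}
    with hG
  have hCm : MeasurableSet {x | C x ≠ y} := hC (MeasurableSet.of_discrete (s := {y}ᶜ))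
  have hEm : MeasurableSet E := measurable_perturb _ l y hCm
  have hGm : MeasurableSet G := measurableSet_le measurable_const (measurable_perturbCount _ l y)
  have harrow := measurePreserving_arrowProdEquivProdArrow ℝ ℝ (Fin d)
    (fun i => gaussianReal (((y : ℤ) : ℝ) * ν i) 1) (fun _ => uniformUnit)
  -- Separating inputs from seeds allows Fubini: for fixed `z`, either some point of the ball is
  -- misclassified and the supremum is `1`, or no seed lies in `E \ G`.
  have hmain : seededLaw ν y (E \ G) ≤ labelError ν C (headL1 ν l * t) y := by
    have hsym := harrow.symm
    rw [seededLaw, ← hsym.measure_preimage (hEm.diff hGm).nullMeasurableSet,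
      Measure.prod_apply (hsym.measurable (hEm.diff hGm)), labelError, shiftedGaussian]
    refine lintegral_mono fun z => ?_
    by_cases hsup : ∃ z', (hammingNorm (z - z') : ℝ) ≤ headL1 ν l * t ∧ C z' ≠ y
    · obtain ⟨z', hz', hCz'⟩ := hsup
      refine prob_le_one.trans ?_
      refine le_trans ?_ (le_iSup₂ (f := fun z' (_ : z' ∈ {z' : Fin d → ℝ |
        (hammingNorm (z - z') : ℝ) ≤ headL1 ν l * t}) =>
          (if C z' ≠ y then 1 else 0 : ℝ≥0∞)) z' hz')
      simp [hCz']
    · have hempty : Prod.mk z ⁻¹'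
          ((MeasurableEquiv.arrowProdEquivProdArrow ℝ ℝ (Fin d)).symm ⁻¹' (E \ G)) = ∅ := by
        refine Set.eq_empty_of_forall_notMem fun u hu => hsup ?_
        obtain ⟨h1, h2⟩ := hu
        refine ⟨_, ?_, h1⟩
        have h3 := (hammingNorm_sub_perturb_le ν l y _).trans_lt (not_le.1 h2)
        have h4 := (ENNReal.ofReal_natCast _ ▸ h3 : ENNReal.ofReal _ < _)
        exact ((ENNReal.ofReal_lt_ofReal_iff (mul_pos hl ht)).1 h4).le
      rw [hempty, measure_empty]
      exact zero_le
  calc Measure.pi (erasedLaw ν l y) {x | C x ≠ y}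
      = seededLaw ν y E := by
        rw [← map_perturb, Measure.map_apply (measurable_perturb _ l y) hCm]
        rfl
    _ ≤ seededLaw ν y (E \ G) + seededLaw ν y G := by
        refine (measure_mono ?_).trans (measure_union_le _ _)
        intro p hp
        by_cases h : p ∈ G
        · exact Or.inr h
        · exact Or.inl ⟨hp, h⟩
    _ ≤ _ := add_le_add hmain (prob_perturb_gt_le hl ht y)

end erasure

/-! ### The lower bound and the conclusion. -/

theorem gaussianTail_sub_le_labelError {d : ℕ} {ν : EuclideanSpace ℝ (Fin d)} (hd : 2 ≤ d)
    (hnorm : ‖ν‖ = 1) {c : ℝ} (hc0 : 0 < c) (hc1 : c ≤ 1) {C : (Fin d → ℝ) → ℤˣ}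
    (hC : Measurable C) :
    ENNReal.ofReal (gaussianTail (√(1 - c ^ 2)) - 1 / Real.log d) ≤
      2⁻¹ * (labelError ν C (headL1 ν (headLength ν c) * Real.log d) 1 +
        labelError ν C (headL1 ν (headLength ν c) * Real.log d) (-1)) := by
  obtain ⟨hl1, hld, hcl⟩ := headLength_mem (by omega) hnorm hc1
  set l := headLength ν c
  have ht : 0 < Real.log d := Real.log_pos (by exact_mod_cast hd)
  -- Markov's inequality needs a positive budget; a zero head would contradict `0 < c ≤ headL2 ν l`.
  have hl : 0 < headL1 ν l := by
    refine (Finset.sum_nonneg fun _ _ => abs_nonneg _).lt_of_ne fun h => ?_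
    have h0 := (Finset.sum_eq_zero_iff_of_nonneg fun _ _ => abs_nonneg _).1 h.symm
    have : headL2 ν l = 0 := by
      rw [headL2, Finset.sum_eq_zero fun i hi => ?_, Real.sqrt_zero]
      rw [abs_eq_zero.1 (h0 i hi), zero_pow two_ne_zero]
    linarith
  set s := √(1 - headL2 ν l ^ 2) with hs
  have hssq : ∑ i : Fin d, (if i.val < l then 0 else ν i) ^ 2 = s ^ 2 := by
    rw [sum_tail_sq hnorm, hs, Real.sq_sqrt (by linarith [headL2_sq_le_one hnorm l])]
  have hsq : s ≤ √(1 - c ^ 2) := Real.sqrt_le_sqrt (by nlinarith)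
  have hA : MeasurableSet {x | C x ≠ 1} := hC (MeasurableSet.of_discrete (s := {1}ᶜ))
  have hAc : {x | C x ≠ 1}ᶜ = {x | C x ≠ -1} := by
    ext x
    rcases Int.units_eq_one_or (C x) with h | h <;> simp [h]
  have h1 := two_mul_gaussianTail_le ν l (Real.sqrt_nonneg _) hssq hA
  rw [hAc] at h1
  have h2 := h1.trans (add_le_add (erasedLaw_le_labelError hl ht hC 1)
    (erasedLaw_le_labelError hl ht hC (-1)))
  rw [add_add_add_comm, ← two_mul (ENNReal.ofReal (1 / Real.log d))] at h2
  have h3 := mul_le_mul_right h2 (2⁻¹ : ℝ≥0∞)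
  rw [mul_add, ← mul_assoc, ← mul_assoc, ENNReal.inv_mul_cancel two_ne_zero ENNReal.ofNat_ne_top,
    one_mul, one_mul] at h3
  rw [ENNReal.ofReal_sub _ (by positivity), tsub_le_iff_right]
  exact (ENNReal.ofReal_le_ofReal (gaussianTail_antitone hsq)).trans h3

end SparseRobust

theorem theorem4 {d : ℕ} (hd : 2 ≤ d)
    (μ ν : EuclideanSpace ℝ (Fin d)) (S : Matrix (Fin d) (Fin d) ℝ)
    (hS : S.PosDef) (hdiag : S.IsDiag)
    (hν : ν = SparseRobust.normalizedMean μ S) (hnorm : ‖ν‖ = 1)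
    (hsorted : ∀ i j : Fin d, i ≤ j → |ν j| ≤ |ν i|) :
    (∀ c : ℝ, 0 ≤ c → c < 1 →
      SparseRobust.optRobustError μ S
          (SparseRobust.headL1 ν (SparseRobust.headLength ν c) / Real.log d) ≤
        1 / √(2 * Real.log d) +
          SparseRobust.gaussianTail
            (√(1 - c ^ 2) - 16 * √2 / (√(1 - c ^ 2) * √(Real.log d)))) ∧
    (∀ c : ℝ, 0 < c → c ≤ 1 →
      SparseRobust.gaussianTail (√(1 - c ^ 2)) - 1 / Real.log d ≤
        SparseRobust.optRobustError μ S
          (SparseRobust.headL1 ν (SparseRobust.headLength ν c) * Real.log d)) := by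
  constructor
  · intro c hc0 hc1
    obtain ⟨C, hC, hle⟩ := SparseRobust.exists_labelError_le hd hnorm hsorted hc0 hc1
    refine ENNReal.toReal_le_of_le_ofReal
      (add_nonneg (by positivity) (SparseRobust.gaussianTail_nonneg _)) ?_
    refine (iInf_le _ ⟨C ∘ SparseRobust.unscale S,
      hC.comp (SparseRobust.measurable_unscale S)⟩).trans ?_
    have hcomp : (C ∘ SparseRobust.unscale S) ∘ SparseRobust.rescale S = C := by
      ext1 z
      simp [SparseRobust.unscale_rescale hS]
    rw [SparseRobust.robustError_eq_labelError μ hS hdiag, hcomp, ← hν]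
    refine (mul_le_mul_right (add_le_add (hle 1) (hle (-1))) _).trans ?_
    rw [← two_mul, ← mul_assoc, ENNReal.inv_mul_cancel two_ne_zero ENNReal.ofNat_ne_top, one_mul]
  · intro c hc0 hc1
    -- Finiteness matters because `toReal` sends `⊤` to `0`, which would break a lower bound.
    have hfin : ∀ C k, SparseRobust.robustError μ S C k ≠ ⊤ := by
      intro C k
      rw [SparseRobust.robustError_eq_labelError μ hS hdiag]
      have hlabel : ∀ y, SparseRobust.labelError (SparseRobust.normalizedMean μ S)
          (C ∘ SparseRobust.rescale S) k y ≤ 1 := by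
        intro y
        refine (MeasureTheory.lintegral_mono (g := fun _ => 1) fun z => iSup₂_le fun z' _ => ?_).trans
          (by simp)
        split_ifs <;> simp
      refine ENNReal.mul_ne_top (by simp) (ENNReal.add_ne_top.2 ⟨?_, ?_⟩) <;>
        exact ne_top_of_le_ne_top ENNReal.one_ne_top (hlabel _)
    refine (ENNReal.ofReal_le_iff_le_toReal ?_).1 (le_iInf fun C => ?_)
    · exact ne_top_of_le_ne_top (hfin (fun _ => 1) _)
        (iInf_le _ (⟨fun _ => 1, measurable_const⟩ :
          {C : EuclideanSpace ℝ (Fin d) → ℤˣ // Measurable C}))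
    · rw [SparseRobust.robustError_eq_labelError μ hS hdiag, ← hν]
      exact SparseRobust.gaussianTail_sub_le_labelError hd hnorm hc0 hc1
        (C.2.comp (SparseRobust.measurable_rescale S))
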